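/- Let $\{X_k, k\in\mathbb{N}\}$ be a standardized Gaussian process on a probability space, i.e. every finite subfamily $(X_{k_1},\dots,X_{k_m})$ is (possibly degenerate) multivariate Gaussian and $X_k\sim\mathcal N(0,1)$ for every $k$. Let $\Phi$ be the cumulative distribution function of the standard Gaussian distribution, and for $n\ge 1$ and $t\in\mathbb{R}$ put $$\widehat F_n(t)=\frac1n\sum_{i=1}^n \mathbf 1(\Phi(X_i)\le t),\qquad \Delta(n)=2\sum_{1\le i<j\le n}|\mathrm{Cov}(X_i,X_j)|.$$ If, for some $\delta>0$, $\Delta(n)=O\!\left(n^2(\ln n)^{-3-\delta}\right)$ as $n\to\infty$, then $$\sup_{t\in\mathbb R}\left|\widehat F_n(t)-\mathbf E\widehat F_n(t)\right|\longrightarrow 0\quad\text{almost surely as } n\to\infty.$$ -/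

import Mathlib

open MeasureTheory ProbabilityTheory Filter Topology Asymptotics

noncomputable section

/-- A standardized Gaussian process `{X_k, k ∈ ℕ}`: all finite-dimensional distributions are
(possibly degenerate) multivariate Gaussian, and every `X_k` has law `N(0, 1)`. -/
structure IsStandardizedGaussianProcess {Ω : Type*} [MeasurableSpace Ω]
    (X : ℕ → Ω → ℝ) (P : Measure Ω) : Prop where
  isGaussianProcess : IsGaussianProcess X P
  hasLaw : ∀ k, HasLaw (X k) (gaussianReal 0 1) P

/-- The cumulative distribution function `Φ` of the standard Gaussian distribution. -/
def stdGaussianCDF (x : ℝ) : ℝ := cdf (gaussianReal 0 1) x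

/-- The empirical distribution function
`F̂_n(t) = (1/n) ∑_{i=1}^n 1(Φ(X_i) ≤ t)`, evaluated at the sample point `ω`. -/
def empiricalDist {Ω : Type*} (X : ℕ → Ω → ℝ) (n : ℕ) (t : ℝ) (ω : Ω) : ℝ :=
  (1 / (n : ℝ)) * ∑ i ∈ Finset.Icc 1 n,
    Set.indicator {ω' : Ω | stdGaussianCDF (X i ω') ≤ t} (fun _ => (1 : ℝ)) ω

/-- The dependence measure `Δ(n) = 2 ∑_{1 ≤ i < j ≤ n} |Cov(X_i, X_j)|`. -/
def dependenceMeasure {Ω : Type*} [MeasurableSpace Ω] (X : ℕ → Ω → ℝ) (P : Measure Ω)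
    (n : ℕ) : ℝ :=
  2 * ∑ j ∈ Finset.Icc 1 n, ∑ i ∈ Finset.Ico 1 j, |covariance (X i) (X j) P|

/-- The uniform deviation `sup_t |F̂_n(t) - E F̂_n(t)|` over `t ∈ ℝ`, at the sample point `ω`.
The supremum is over a set bounded by `1`, see `bddAbove_range_empiricalDist_sub`. -/
def uniformDeviation {Ω : Type*} [MeasurableSpace Ω] (X : ℕ → Ω → ℝ) (P : Measure Ω)
    (n : ℕ) (ω : Ω) : ℝ :=
  ⨆ t : ℝ, |empiricalDist X n t ω - ∫ ω', empiricalDist X n t ω' ∂P|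

theorem empiricalDist_mem_Icc {Ω : Type*} (X : ℕ → Ω → ℝ) (n : ℕ) (t : ℝ) (ω : Ω) :
    empiricalDist X n t ω ∈ Set.Icc (0 : ℝ) 1 := by
  have h0 : ∀ i ∈ Finset.Icc 1 n, 0 ≤
      Set.indicator {ω' : Ω | stdGaussianCDF (X i ω') ≤ t} (fun _ => (1 : ℝ)) ω :=
    fun i _ => Set.indicator_nonneg (fun _ _ => zero_le_one) ω
  have h1 : ∀ i ∈ Finset.Icc 1 n,
      Set.indicator {ω' : Ω | stdGaussianCDF (X i ω') ≤ t} (fun _ => (1 : ℝ)) ω ≤ 1 :=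
    fun i _ => Set.indicator_le_self' (fun _ _ => zero_le_one) ω
  refine ⟨mul_nonneg (by positivity) (Finset.sum_nonneg h0), ?_⟩
  have h2 := Finset.sum_le_card_nsmul _ _ _ h1
  simp only [Nat.card_Icc, Nat.add_sub_cancel, nsmul_eq_mul, mul_one] at h2
  unfold empiricalDist
  rcases Nat.eq_zero_or_pos n with rfl | hn
  · simp
  · have hn' : (0 : ℝ) < n := by exact_mod_cast hn
    rw [one_div_mul_eq_div]
    exact (div_le_one hn').2 h2

theorem bddAbove_range_empiricalDist_sub {Ω : Type*} [MeasurableSpace Ω] (X : ℕ → Ω → ℝ)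
    (P : Measure Ω) [IsProbabilityMeasure P] (n : ℕ) (ω : Ω) :
    BddAbove (Set.range fun t : ℝ =>
      |empiricalDist X n t ω - ∫ ω', empiricalDist X n t ω' ∂P|) := by
  refine ⟨1, ?_⟩
  rintro _ ⟨t, rfl⟩
  have h := empiricalDist_mem_Icc X n t
  have hE0 : 0 ≤ ∫ ω', empiricalDist X n t ω' ∂P := integral_nonneg fun ω' => (h ω').1
  have hE1 : ∫ ω', empiricalDist X n t ω' ∂P ≤ 1 := by
    by_cases hi : Integrable (empiricalDist X n t) P
    · calc ∫ ω', empiricalDist X n t ω' ∂P ≤ ∫ _, (1 : ℝ) ∂P :=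
            integral_mono hi (integrable_const _) fun ω' => (h ω').2
        _ = 1 := by simp
    · rw [integral_undef hi]; exact zero_le_one
  have h1 := h ω
  rw [abs_le]
  constructor <;> linarith [h1.1, h1.2]

end

/-! Each Φ(X_i) is uniform on [0, 1], so for n ≥ 1 the mean of F̂_n(t) is max(0, min(t, 1)), and for
0 < t < 1 the event Φ(X_i) ≤ t is X_i ≤ b with Φ(b) = t. The key is a linear bound for a standard
Gaussian pair, |Cov(1(X ≤ a), 1(Y ≤ b))| ≤ 2 |Cov(X, Y)|
(`HasGaussianLaw.abs_covariance_indicator_le`), obtained by comparing Y with its regression residual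
on X. Summed over pairs it gives Var(n F̂_n(t)) ≤ 2 (n + Δ(n)) = O(n² (ln n)^(-a)) with a = 3 + δ.

Along n_k = ⌊c^k⌋, c > 1, the variances of F̂_{n_k}(t) are O(k^(-a)), summable as soon as a > 1, so
these averages converge almost surely. Monotone partial sums and ratios c → 1 fill the gaps. This
holds almost surely at all rational t simultaneously, and a Glivenko–Cantelli grid argument makes
the convergence uniform. -/

/-- A real Gaussian measure of variance at least `1 / 4` gives an interval at most its length. -/
theorem gaussianReal_Icc_le (m : ℝ) {v : NNReal} (hv : (1 / 4 : ℝ) ≤ v) (a b : ℝ) :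
    gaussianReal m v (Set.Icc a b) ≤ ENNReal.ofReal (b - a) := by
  have hv0 : v ≠ 0 := by
    rintro rfl
    norm_num at hv
  have hpdf (x : ℝ) : gaussianPDF m v x ≤ 1 := by
    rw [gaussianPDF, ENNReal.ofReal_le_one, gaussianPDFReal]
    refine mul_le_one₀ (inv_le_one_of_one_le₀ ?_) (Real.exp_nonneg _) ?_
    · rw [Real.one_le_sqrt]
      -- The density peaks at 1 / √(2πv), and 2πv ≥ π/2 > 1.
      nlinarith [Real.pi_gt_three]
    · rw [Real.exp_le_one_iff]
      exact div_nonpos_of_nonpos_of_nonneg (neg_nonpos.2 (sq_nonneg _)) (by positivity)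
  calc gaussianReal m v (Set.Icc a b) = ∫⁻ x in Set.Icc a b, gaussianPDF m v x :=
        gaussianReal_apply m hv0 _
    _ ≤ ∫⁻ _ in Set.Icc a b, 1 := lintegral_mono hpdf
    _ = ENNReal.ofReal (b - a) := by simp

/-! ### The standard Gaussian distribution function -/

theorem strictMono_stdGaussianCDF : StrictMono stdGaussianCDF := by
  intro x y hxy
  have h : 0 < (gaussianReal 0 1).real (Set.Ioc x y) := by
    refine ENNReal.toReal_pos (fun h => ?_) (measure_ne_top _ _)
    have := gaussianReal_absolutelyContinuous' 0 one_ne_zero h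
    exact hxy.not_ge (by simpa using this)
  have h2 : stdGaussianCDF y = stdGaussianCDF x + (gaussianReal 0 1).real (Set.Ioc x y) := by
    simp only [stdGaussianCDF, cdf_eq_real]
    rw [← measureReal_union (Set.Iic_disjoint_Ioc le_rfl) measurableSet_Ioc,
      Set.Iic_union_Ioc_eq_Iic hxy.le]
  linarith

theorem continuous_stdGaussianCDF : Continuous stdGaussianCDF := by
  have key : ∀ x y, x ≤ y → stdGaussianCDF y - stdGaussianCDF x ≤ y - x := by
    intro x y hxy
    have h2 : stdGaussianCDF y = stdGaussianCDF x + (gaussianReal 0 1).real (Set.Ioc x y) := by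
      simp only [stdGaussianCDF, cdf_eq_real]
      rw [← measureReal_union (Set.Iic_disjoint_Ioc le_rfl) measurableSet_Ioc,
        Set.Iic_union_Ioc_eq_Iic hxy]
    have h3 : (gaussianReal 0 1).real (Set.Ioc x y) ≤ y - x := by
      refine ENNReal.toReal_le_of_le_ofReal (by linarith) ?_
      exact (measure_mono Set.Ioc_subset_Icc_self).trans
        (gaussianReal_Icc_le 0 (by norm_num) x y)
    linarith
  refine (LipschitzWith.of_dist_le_mul (K := 1) fun x y => ?_).continuous
  rw [NNReal.coe_one, one_mul, Real.dist_eq, Real.dist_eq]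
  rcases le_total x y with h | h
  · rw [abs_sub_comm, abs_sub_comm x, abs_of_nonneg (sub_nonneg.2 h),
      abs_of_nonneg (sub_nonneg.2 (strictMono_stdGaussianCDF.monotone h))]
    exact key x y h
  · rw [abs_of_nonneg (sub_nonneg.2 h),
      abs_of_nonneg (sub_nonneg.2 (strictMono_stdGaussianCDF.monotone h))]
    exact key y x h

theorem stdGaussianCDF_pos (x : ℝ) : 0 < stdGaussianCDF x :=
  (cdf_nonneg _ _).trans_lt (strictMono_stdGaussianCDF (sub_one_lt x))

theorem stdGaussianCDF_lt_one (x : ℝ) : stdGaussianCDF x < 1 :=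
  (strictMono_stdGaussianCDF (lt_add_one x)).trans_le (cdf_le_one _ _)

theorem exists_stdGaussianCDF_eq {t : ℝ} (h0 : 0 < t) (h1 : t < 1) :
    ∃ b, stdGaussianCDF b = t := by
  obtain ⟨x, hx⟩ := ((tendsto_cdf_atBot (gaussianReal 0 1)).eventually_lt_const h0).exists
  obtain ⟨y, hy⟩ := ((tendsto_cdf_atTop (gaussianReal 0 1)).eventually_const_lt h1).exists
  obtain ⟨b, hb⟩ := mem_range_of_exists_le_of_exists_ge continuous_stdGaussianCDF
    ⟨x, hx.le⟩ ⟨y, hy.le⟩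
  exact ⟨b, hb⟩

/-- The probability integral transform: `Φ` maps the standard Gaussian law to the uniform law. -/
theorem gaussianReal_real_stdGaussianCDF_le (t : ℝ) :
    (gaussianReal 0 1).real {x | stdGaussianCDF x ≤ t} = max 0 (min t 1) := by
  rcases le_or_gt t 0 with h0 | h0
  · have : {x | stdGaussianCDF x ≤ t} = ∅ :=
      Set.eq_empty_of_forall_notMem fun x hx =>
        (stdGaussianCDF_pos x).not_ge (le_trans hx h0)
    rw [this, max_eq_left ((min_le_left _ _).trans h0), measureReal_empty]
  rcases le_or_gt 1 t with h1 | h1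
  · have : {x | stdGaussianCDF x ≤ t} = Set.univ :=
      Set.eq_univ_of_forall fun x => (stdGaussianCDF_lt_one x).le.trans h1
    rw [this, min_eq_right h1, max_eq_right zero_le_one, probReal_univ]
  · obtain ⟨b, rfl⟩ := exists_stdGaussianCDF_eq h0 h1
    rw [min_eq_left h1.le, max_eq_right h0.le]
    simp only [strictMono_stdGaussianCDF.le_iff_le]
    exact (cdf_eq_real _ _).symm

/-! ### Covariance of half-line indicators for a Gaussian pair -/

section Pair

variable {Ω : Type*} [MeasurableSpace Ω] {P : Measure Ω} {X Y : Ω → ℝ}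

/-- Since Var X = 1, the residual is uncorrelated with X; joint Gaussianity turns this into
independence. -/
theorem HasGaussianLaw.indepFun_sub_covariance_mul (hX : HasLaw X (gaussianReal 0 1) P)
    (hXY : HasGaussianLaw (fun ω => (X ω, Y ω)) P) :
    IndepFun X (fun ω => Y ω - cov[X, Y; P] * X ω) P := by
  have := hX.isProbabilityMeasure
  have hX2 := hXY.fst.memLp_two
  have hY2 := hXY.snd.memLp_two
  have hG : HasGaussianLaw (fun ω => (X ω, Y ω - cov[X, Y; P] * X ω)) P :=
    hXY.map_fun ((ContinuousLinearMap.fst ℝ ℝ ℝ).prod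
      (ContinuousLinearMap.snd ℝ ℝ ℝ - cov[X, Y; P] • ContinuousLinearMap.fst ℝ ℝ ℝ))
  refine hG.indepFun_of_covariance_eq_zero ?_
  rw [covariance_fun_sub_right hX2 hY2 (hX2.const_mul _), covariance_const_mul_right,
    covariance_self hX.aemeasurable, hX.variance_eq]
  simp

theorem HasGaussianLaw.hasLaw_sub_covariance_mul (hX : HasLaw X (gaussianReal 0 1) P)
    (hY : HasLaw Y (gaussianReal 0 1) P) (hXY : HasGaussianLaw (fun ω => (X ω, Y ω)) P) :
    HasLaw (fun ω => Y ω - cov[X, Y; P] * X ω)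
      (gaussianReal 0 (1 - cov[X, Y; P] ^ 2).toNNReal) P := by
  have := hX.isProbabilityMeasure
  have hX2 := hXY.fst.memLp_two
  have hY2 := hXY.snd.memLp_two
  have hG : HasGaussianLaw (fun ω => Y ω - cov[X, Y; P] * X ω) P :=
    hXY.map_fun (ContinuousLinearMap.snd ℝ ℝ ℝ - cov[X, Y; P] • ContinuousLinearMap.fst ℝ ℝ ℝ)
  refine ⟨hG.aemeasurable, ?_⟩
  rw [hG.map_eq_gaussianReal]
  congr 2
  · rw [integral_sub hXY.snd.integrable (hXY.fst.integrable.const_mul _), integral_const_mul,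
      hX.integral_eq, hY.integral_eq]
    simp
  · rw [variance_fun_sub hY2 (hX2.const_mul _), variance_const_mul, covariance_const_mul_right,
      covariance_comm Y X, hX.variance_eq, hY.variance_eq]
    simp
    ring

/-- The L¹ norm is at most the L² norm, which is 1. -/
theorem lintegral_enorm_le_one_of_hasLaw (hX : HasLaw X (gaussianReal 0 1) P) :
    ∫⁻ ω, ‖X ω‖ₑ ∂P ≤ 1 := by
  have := hX.isProbabilityMeasure
  have hX2 : MemLp X 2 P := hX.hasGaussianLaw.memLp_two
  have h1 : ∫⁻ ω, ‖X ω‖ₑ ∂P = eLpNorm X 1 P := eLpNorm_one_eq_lintegral_enorm.symm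
  have hv : ∫ ω, X ω ^ 2 ∂P = 1 := by
    have h := variance_of_integral_eq_zero hX.aemeasurable
      (by rw [hX.integral_eq]; simp)
    rw [hX.variance_eq] at h
    simpa using h.symm
  rw [h1]
  refine (eLpNorm_le_eLpNorm_of_exponent_le (by norm_num : (1 : ENNReal) ≤ 2)
    hX2.aestronglyMeasurable).trans ?_
  rw [hX2.eLpNorm_eq_integral_rpow_norm (by norm_num) (by norm_num)]
  simp [hv]

/-- For a jointly Gaussian standard pair, the residual `Z = Y - ρ X` is within `|ρ X|` of a given
level `b` with probability at most `2 |ρ|`. -/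
theorem HasGaussianLaw.measure_abs_residual_sub_le (hX : HasLaw X (gaussianReal 0 1) P)
    (hY : HasLaw Y (gaussianReal 0 1) P) (hXY : HasGaussianLaw (fun ω => (X ω, Y ω)) P)
    (hρ : |cov[X, Y; P]| ≤ 1 / 2) (b : ℝ) :
    P {ω | |Y ω - cov[X, Y; P] * X ω - b| ≤ |cov[X, Y; P]| * |X ω|} ≤
      ENNReal.ofReal (2 * |cov[X, Y; P]|) := by
  have := hX.isProbabilityMeasure
  set ρ := cov[X, Y; P] with hρdef
  have hZ := HasGaussianLaw.hasLaw_sub_covariance_mul hX hY hXY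
  have hind := HasGaussianLaw.indepFun_sub_covariance_mul hX hXY
  rw [← hρdef] at hZ hind
  have hmap := (indepFun_iff_map_prod_eq_prod_map_map hX.aemeasurable hZ.aemeasurable).1 hind
  rw [hX.map_eq, hZ.map_eq] at hmap
  set v := (1 - ρ ^ 2).toNNReal
  have hv : (1 / 4 : ℝ) ≤ v := by
    refine le_trans ?_ (Real.le_coe_toNNReal _)
    have := abs_le.1 hρ
    nlinarith
  have hs : MeasurableSet {p : ℝ × ℝ | |p.2 - b| ≤ |ρ| * |p.1|} :=
    measurableSet_le (by fun_prop) (by fun_prop)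
  -- Given X = x, the independent residual must fall in an interval of length 2 |ρ| |x|; integrating
  -- in x then uses E|X| ≤ 1.
  have hslice (x : ℝ) : gaussianReal 0 v (Prod.mk x ⁻¹' {p : ℝ × ℝ | |p.2 - b| ≤ |ρ| * |p.1|}) ≤
      ENNReal.ofReal (2 * |ρ|) * ‖x‖ₑ := by
    have : Prod.mk x ⁻¹' {p : ℝ × ℝ | |p.2 - b| ≤ |ρ| * |p.1|} =
        Set.Icc (b - |ρ| * |x|) (b + |ρ| * |x|) := by
      ext z
      simp only [Set.mem_preimage, Set.mem_ofPred_eq, Set.mem_Icc, abs_le]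
      constructor <;> rintro ⟨h1, h2⟩ <;> constructor <;> linarith
    rw [this, ← ofReal_norm, Real.norm_eq_abs, ← ENNReal.ofReal_mul (by positivity)]
    exact (gaussianReal_Icc_le 0 hv _ _).trans (ENNReal.ofReal_le_ofReal (by linarith))
  calc P {ω | |Y ω - ρ * X ω - b| ≤ |ρ| * |X ω|}
      = P.map (fun ω => (X ω, Y ω - ρ * X ω)) {p : ℝ × ℝ | |p.2 - b| ≤ |ρ| * |p.1|} :=
        (Measure.map_apply_of_aemeasurable
          (hX.aemeasurable.prodMk hZ.aemeasurable) hs).symm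
    _ = ∫⁻ x, gaussianReal 0 v (Prod.mk x ⁻¹' {p : ℝ × ℝ | |p.2 - b| ≤ |ρ| * |p.1|})
          ∂(gaussianReal 0 1) := by rw [hmap, Measure.prod_apply hs]
    _ ≤ ∫⁻ x, ENNReal.ofReal (2 * |ρ|) * ‖x‖ₑ ∂(gaussianReal 0 1) := lintegral_mono hslice
    _ = ENNReal.ofReal (2 * |ρ|) * ∫⁻ x, ‖x‖ₑ ∂(gaussianReal 0 1) :=
        lintegral_const_mul _ (by fun_prop)
    _ ≤ ENNReal.ofReal (2 * |ρ|) * 1 := by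
        gcongr
        exact lintegral_enorm_le_one_of_hasLaw HasLaw.id
    _ = _ := mul_one _

/-- Only one factor needs centring: Cov(U, V) = E[(U - EU) V], and |U - EU| ≤ 1. -/
theorem abs_covariance_le_integral_abs [IsProbabilityMeasure P] {U V : Ω → ℝ}
    (hU : ∀ ω, U ω ∈ Set.Icc (0 : ℝ) 1) (hUm : AEMeasurable U P) (hV : MemLp V 2 P) :
    |cov[U, V; P]| ≤ ∫ ω, |V ω| ∂P := by
  have hU2 : MemLp U 2 P := memLp_of_bounded (ae_of_all _ hU) hUm.aestronglyMeasurable 2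
  have hVi := hV.integrable one_le_two
  have hE0 : 0 ≤ ∫ ω, U ω ∂P := integral_nonneg fun ω => (hU ω).1
  have hE1 : ∫ ω, U ω ∂P ≤ 1 := by
    simpa using integral_mono (hU2.integrable one_le_two) (integrable_const (1 : ℝ))
      fun ω => (hU ω).2
  have h : cov[U, V; P] = ∫ ω, (U ω - ∫ ω, U ω ∂P) * V ω ∂P := by
    rw [covariance_eq_sub hU2 hV]
    simp only [sub_mul, Pi.mul_apply]
    rw [integral_sub (f := fun ω => U ω * V ω) (hU2.integrable_mul hV) (hVi.const_mul _),
      integral_const_mul]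
  rw [h]
  refine abs_integral_le_integral_abs.trans (integral_mono_of_nonneg
    (ae_of_all _ fun ω => abs_nonneg _) hVi.abs (ae_of_all _ fun ω => ?_))
  simp only [abs_mul]
  refine mul_le_of_le_one_left (abs_nonneg _) (abs_le.2 ⟨?_, ?_⟩) <;>
    linarith [(hU ω).1, (hU ω).2]

/-- For a jointly Gaussian standard pair, the covariance of the indicators of two half-lines is
controlled linearly by the covariance of the pair. -/
theorem HasGaussianLaw.abs_covariance_indicator_le (hX : HasLaw X (gaussianReal 0 1) P)
    (hY : HasLaw Y (gaussianReal 0 1) P) (hXY : HasGaussianLaw (fun ω => (X ω, Y ω)) P)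
    (a b : ℝ) :
    |cov[fun ω => (Set.Iic a).indicator (fun _ => (1 : ℝ)) (X ω),
      fun ω => (Set.Iic b).indicator (fun _ => (1 : ℝ)) (Y ω); P]| ≤ 2 * |cov[X, Y; P]| := by
  have := hX.isProbabilityMeasure
  have hI (c x : ℝ) : (Set.Iic c).indicator (fun _ => (1 : ℝ)) x ∈ Set.Icc (0 : ℝ) 1 := by
    by_cases h : x ∈ Set.Iic c <;> simp [h]
  have hIm (c : ℝ) : Measurable ((Set.Iic c).indicator (fun _ => (1 : ℝ))) :=
    measurable_const.indicator measurableSet_Iic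
  have hL (c : ℝ) {W : Ω → ℝ} (hW : AEMeasurable W P) :
      MemLp (fun ω => (Set.Iic c).indicator (fun _ => (1 : ℝ)) (W ω)) 2 P :=
    memLp_of_bounded (ae_of_all _ fun ω => hI c (W ω))
      ((hIm c).comp_aemeasurable hW).aestronglyMeasurable 2
  have hUm := (hIm a).comp_aemeasurable hX.aemeasurable
  -- For |ρ| > 1/2 the target exceeds 1 and is trivial; otherwise the residual keeps variance at
  -- least 3/4.
  rcases le_or_gt |cov[X, Y; P]| (1 / 2) with hρ | hρ
  · have hZ := (HasGaussianLaw.hasLaw_sub_covariance_mul hX hY hXY).aemeasurable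
    have hind := HasGaussianLaw.indepFun_sub_covariance_mul hX hXY
    have hmeas := HasGaussianLaw.measure_abs_residual_sub_le hX hY hXY hρ b
    set ρ := cov[X, Y; P]
    -- Independence lets the indicator of the residual Z be subtracted from that of Y without
    -- changing the covariance.
    have hzero := (hind.comp (hIm a) (hIm b)).covariance_eq_zero
      (hL a hX.aemeasurable) (hL b hZ)
    have hsub := covariance_sub_right (hL a hX.aemeasurable) (hL b hY.aemeasurable) (hL b hZ)
    simp only [Function.comp_def] at hzero
    rw [hzero, sub_zero] at hsub
    rw [← hsub]
    refine (abs_covariance_le_integral_abs (fun ω => hI a (X ω)) hUm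
      ((hL b hY.aemeasurable).sub (hL b hZ))).trans ?_
    have hA : NullMeasurableSet {ω | |Y ω - ρ * X ω - b| ≤ |ρ| * |X ω|} P :=
      nullMeasurableSet_le (by fun_prop) (by fun_prop)
    -- The two indicators differ only if b separates Y from Z, which are |ρ X| apart.
    calc ∫ ω, |((fun ω => (Set.Iic b).indicator (fun _ => (1 : ℝ)) (Y ω)) -
            fun ω => (Set.Iic b).indicator (fun _ => (1 : ℝ)) (Y ω - ρ * X ω)) ω| ∂P
        ≤ ∫ ω, {ω | |Y ω - ρ * X ω - b| ≤ |ρ| * |X ω|}.indicator 1 ω ∂P := by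
          refine integral_mono_of_nonneg (ae_of_all _ fun ω => abs_nonneg _)
            ((integrable_const (1 : ℝ)).indicator₀ hA) (ae_of_all _ fun ω => ?_)
          simp only [Pi.sub_apply, Set.indicator_apply, Set.mem_Iic, Set.mem_ofPred_eq,
            Pi.one_apply, ← abs_mul]
          split_ifs with h1 h2 h3 h3 h2 h3 h3 <;> try norm_num
          · exact h3 (abs_le.2 ⟨by linarith [neg_abs_le (ρ * X ω), abs_nonneg (ρ * X ω)],
              by linarith [neg_abs_le (ρ * X ω)]⟩)
          · exact h3 (abs_le.2 ⟨by linarith [le_abs_self (ρ * X ω)],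
              by linarith [abs_nonneg (ρ * X ω)]⟩)
      _ = P.real {ω | |Y ω - ρ * X ω - b| ≤ |ρ| * |X ω|} := by
          rw [integral_indicator₀ hA]; simp
      _ ≤ 2 * |ρ| := ENNReal.toReal_le_of_le_ofReal (by positivity) hmeas
  · refine (abs_covariance_le_integral_abs (fun ω => hI a (X ω)) hUm
      (hL b hY.aemeasurable)).trans ?_
    have : ∫ ω, |(Set.Iic b).indicator (fun _ => (1 : ℝ)) (Y ω)| ∂P ≤ ∫ _, (1 : ℝ) ∂P :=
      integral_mono_of_nonneg (ae_of_all _ fun ω => abs_nonneg _) (integrable_const _)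
        (ae_of_all _ fun ω => abs_le.2 ⟨by linarith [(hI b (Y ω)).1], (hI b (Y ω)).2⟩)
    simp only [integral_const, probReal_univ, smul_eq_mul, mul_one] at this
    linarith

end Pair

/-! ### A strong law from variance bounds -/

section StrongLaw

variable {Ω : Type*} [MeasurableSpace Ω] {P : Measure Ω}

/-- Square-integrable variables with a common mean and summable variances converge almost surely
to this mean. -/
theorem ae_tendsto_of_summable_variance [IsProbabilityMeasure P] {Y : ℕ → Ω → ℝ} {p : ℝ}
    (hY : ∀ k, MemLp (Y k) 2 P) (hp : ∀ k, ∫ ω, Y k ω ∂P = p)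
    (hsum : Summable fun k => Var[Y k; P]) :
    ∀ᵐ ω ∂P, Tendsto (fun k => Y k ω) atTop (𝓝 p) := by
  have hm (k : ℕ) : AEMeasurable (fun ω => ‖Y k ω - ∫ ω, Y k ω ∂P‖ₑ ^ 2) P :=
    (((hY k).aemeasurable.sub_const _).enorm).pow_const 2
  -- The series of squared deviations has finite expectation, hence converges almost surely and its
  -- terms tend to 0.
  have hint : ∫⁻ ω, ∑' k, ‖Y k ω - ∫ ω, Y k ω ∂P‖ₑ ^ 2 ∂P ≠ ⊤ := by
    rw [lintegral_tsum hm]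
    have h (k : ℕ) : ∫⁻ ω, ‖Y k ω - ∫ ω, Y k ω ∂P‖ₑ ^ 2 ∂P = ENNReal.ofReal Var[Y k; P] := by
      rw [(hY k).ofReal_variance_eq, evariance]
    simp_rw [h]
    exact hsum.tsum_ofReal_ne_top
  filter_upwards [ae_lt_top' (AEMeasurable.tsum hm) hint] with ω hω
  have h1 := ENNReal.tendsto_atTop_zero_of_tsum_ne_top hω.ne
  have h2 : Tendsto (fun k => Y k ω - ∫ ω, Y k ω ∂P) atTop (𝓝 0) := by
    rw [tendsto_zero_iff_norm_tendsto_zero]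
    have h3 : Tendsto (fun k => (‖Y k ω - ∫ ω, Y k ω ∂P‖ₑ ^ 2).toReal) atTop (𝓝 0) := by
      exact (ENNReal.tendsto_toReal ENNReal.zero_ne_top).comp h1
    simpa [Real.sqrt_sq_eq_abs] using h3.sqrt
  have h5 : Tendsto (fun k => Y k ω - p) atTop (𝓝 0) :=
    h2.congr fun k => by rw [hp k]
  simpa using h5.add_const p

/-- From ⌊c^k⌋ ≥ c^k / 2 the logarithm is at least k ln c - ln 2, hence at least (k ln c) / 2 for
large k. -/
theorem isBigO_log_floor_pow_rpow {c : ℝ} (hc : 1 < c) {a : ℝ} (ha : 0 ≤ a) :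
    (fun k : ℕ => Real.log (⌊c ^ k⌋₊ : ℝ) ^ (-a)) =O[atTop] fun k : ℕ => (k : ℝ) ^ (-a) := by
  have hlc := Real.log_pos hc
  refine IsBigO.of_bound ((Real.log c / 2) ^ (-a)) ?_
  have hk : ∀ᶠ k : ℕ in atTop, Real.log 2 / (Real.log c / 2) ≤ (k : ℝ) :=
    tendsto_natCast_atTop_atTop.eventually_ge_atTop _
  filter_upwards [hk, eventually_gt_atTop 0] with k hk hk0
  rw [div_le_iff₀ (by positivity)] at hk
  have hk0' : (0 : ℝ) < k := by exact_mod_cast hk0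
  have hfl : c ^ k / 2 ≤ (⌊c ^ k⌋₊ : ℝ) := by
    have h1 : (1 : ℝ) ≤ ⌊c ^ k⌋₊ := by
      exact_mod_cast Nat.floor_pos.2 (one_le_pow₀ hc.le : (1 : ℝ) ≤ c ^ k)
    have h2 := Nat.lt_floor_add_one (c ^ k)
    linarith
  have hlog : Real.log c / 2 * k ≤ Real.log (⌊c ^ k⌋₊ : ℝ) := by
    have h := Real.log_le_log (by positivity) hfl
    rw [Real.log_div (by positivity) (by norm_num), Real.log_pow] at h
    linarith
  have hpos : 0 < Real.log c / 2 * k := by positivity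
  rw [Real.norm_of_nonneg (Real.rpow_nonneg (hpos.le.trans hlog) _),
    Real.norm_of_nonneg (Real.rpow_nonneg hk0'.le _),
    ← Real.mul_rpow (by positivity) hk0'.le]
  exact Real.rpow_le_rpow_of_nonpos hpos hlog (neg_nonpos.2 ha)

/-- A strong law of large numbers for variables with values in `[0, 1]` and a common mean, when
the variance of the `n`-th partial sum is `O(n² (log n)^(-a))` for some `a > 1`. -/
theorem ae_tendsto_sum_div_of_isBigO_variance [IsProbabilityMeasure P] {U : ℕ → Ω → ℝ} {p a : ℝ}
    (hU : ∀ i ω, U i ω ∈ Set.Icc (0 : ℝ) 1) (hUm : ∀ i, AEMeasurable (U i) P)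
    (hp : ∀ i, ∫ ω, U i ω ∂P = p) (ha : 1 < a)
    (hvar : (fun n : ℕ => Var[fun ω => ∑ i ∈ Finset.Icc 1 n, U i ω; P]) =O[atTop]
      fun n : ℕ => (n : ℝ) ^ 2 * Real.log n ^ (-a)) :
    ∀ᵐ ω ∂P, Tendsto (fun n : ℕ => (∑ i ∈ Finset.Icc 1 n, U i ω) / n) atTop (𝓝 p) := by
  have hU2 (i : ℕ) : MemLp (U i) 2 P :=
    memLp_of_bounded (ae_of_all _ (hU i)) (hUm i).aestronglyMeasurable 2
  have hS2 (n : ℕ) : MemLp (fun ω => ∑ i ∈ Finset.Icc 1 n, U i ω) 2 P :=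
    memLp_finsetSum _ fun i _ => hU2 i
  have hsub (c : ℝ) (hc : 1 < c) : ∀ᵐ ω ∂P, Tendsto
      (fun k : ℕ => (∑ i ∈ Finset.Icc 1 ⌊c ^ k⌋₊, U i ω) / ⌊c ^ k⌋₊) atTop (𝓝 p) := by
    have hfl : Tendsto (fun k : ℕ => ⌊c ^ k⌋₊) atTop atTop :=
      tendsto_nat_floor_atTop.comp (tendsto_pow_atTop_atTop_of_one_lt hc)
    have hne (k : ℕ) : (⌊c ^ k⌋₊ : ℝ) ≠ 0 := by
      exact_mod_cast (Nat.floor_pos.2 (one_le_pow₀ hc.le : (1 : ℝ) ≤ c ^ k)).ne'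
    refine ae_tendsto_of_summable_variance
      (Y := fun k ω => (∑ i ∈ Finset.Icc 1 ⌊c ^ k⌋₊, U i ω) / ⌊c ^ k⌋₊)
      (fun k => by simpa only [div_eq_mul_inv] using (hS2 _).mul_const _)
      (fun k => ?_) ?_
    · rw [integral_div, integral_finsetSum _ fun i _ => (hU2 i).integrable one_le_two]
      simp only [hp, Finset.sum_const, Nat.card_Icc, Nat.add_sub_cancel, nsmul_eq_mul]
      field_simp [hne k]
    · have h1 := ((hvar.comp_tendsto hfl).mul
        (isBigO_refl (fun k : ℕ => ((⌊c ^ k⌋₊ : ℝ) ^ 2)⁻¹) atTop)).trans_eventuallyEq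
          (g₂ := fun k : ℕ => Real.log (⌊c ^ k⌋₊ : ℝ) ^ (-a))
          (Eventually.of_forall fun k => by
            have := hne k
            simp only [Function.comp_apply]
            field_simp)
      refine summable_of_isBigO_nat (Real.summable_nat_rpow.2 (neg_lt_neg ha))
        ((h1.trans (isBigO_log_floor_pow_rpow hc (by linarith))).congr_left fun k => ?_)
      simp only [Function.comp_apply, div_eq_mul_inv]
      rw [variance_mul_const, inv_pow]
  have hall : ∀ᵐ ω ∂P, ∀ m : ℕ, Tendsto (fun k : ℕ =>
      (∑ i ∈ Finset.Icc 1 ⌊(1 + 1 / ((m : ℝ) + 1)) ^ k⌋₊, U i ω) /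
        ⌊(1 + 1 / ((m : ℝ) + 1)) ^ k⌋₊) atTop (𝓝 p) :=
    ae_all_iff.2 fun m => hsub _ (lt_add_of_pos_right _ (by positivity))
  filter_upwards [hall] with ω hω
  refine tendsto_div_of_monotone_of_tendsto_div_floor_pow
    (fun n => ∑ i ∈ Finset.Icc 1 n, U i ω) p ?_ (fun m : ℕ => 1 + 1 / ((m : ℝ) + 1))
    (fun m => lt_add_of_pos_right _ (by positivity)) ?_ hω
  · intro m n hmn
    exact Finset.sum_le_sum_of_subset_of_nonneg (Finset.Icc_subset_Icc_right hmn)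
      fun i _ _ => (hU i ω).1
  · simpa using tendsto_one_div_add_atTop_nhds_zero_nat.const_add (1 : ℝ)

end StrongLaw

/-! ### From pointwise to uniform convergence -/

theorem abs_sub_le_of_grid {F G : ℝ → ℝ} (hF : Monotone F) (hG : Monotone G) {ε x y t : ℝ}
    (hxt : x ≤ t) (hty : t ≤ y) (hx : |F x - G x| ≤ ε) (hy : |F y - G y| ≤ ε)
    (hxy : G y - G x ≤ ε) : |F t - G t| ≤ 2 * ε := by
  -- F x - G y ≤ F t - G t ≤ F y - G x: each end costs ε at a grid point and ε for the increment of
  -- G.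
  have h1 := hF hxt
  have h2 := hF hty
  have h3 := hG hxt
  have h4 := hG hty
  rw [abs_le] at *
  constructor <;> linarith [hx.1, hx.2, hy.1, hy.2]

/-- Pointwise convergence on the rationals of distribution functions on `[0, 1]` to the uniform
distribution function is uniform. -/
theorem eventually_forall_abs_sub_le_of_tendsto {F : ℕ → ℝ → ℝ} (hF : ∀ n, Monotone (F n))
    (hlim : ∀ q : ℚ, Tendsto (fun n => F n q) atTop (𝓝 (max 0 (min (q : ℝ) 1))))
    (hF01 : ∀ n t, F n t ∈ Set.Icc (0 : ℝ) 1) {ε : ℝ} (hε : 0 < ε) :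
    ∀ᶠ n in atTop, ∀ t, |F n t - max 0 (min t 1)| ≤ ε := by
  obtain ⟨m, hm⟩ := exists_nat_one_div_lt (half_pos hε)
  set G : ℝ → ℝ := fun t => max 0 (min t 1)
  have hG : Monotone G := fun s t h => max_le_max le_rfl (min_le_min h le_rfl)
  have hm0 : (0 : ℝ) < m + 1 := by positivity
  -- The m + 2 nodes k / (m + 1) include 0 and 1, which control all t outside (0, 1); the mesh is
  -- below ε / 2.
  have hgrid : ∀ᶠ n in atTop, ∀ k ∈ Finset.range (m + 2),
      |F n (k / (m + 1)) - G (k / (m + 1))| ≤ ε / 2 := by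
    refine (Finset.eventually_all _).2 fun k _ => ?_
    have h := hlim ((k : ℚ) / (m + 1))
    push_cast at h
    filter_upwards [(Metric.tendsto_nhds.1 h) (ε / 2) (half_pos hε)] with n hn
    exact hn.le
  filter_upwards [hgrid] with n hn t
  rcases le_or_gt t 0 with h0 | h0
  · have h := hn 0 (by simp)
    have hG0 : G t = 0 := by simp [G, h0]
    simp only [Nat.cast_zero, zero_div] at h
    have hG00 : G 0 = 0 := by simp [G]
    have h1 := hF n h0
    change |F n t - G t| ≤ ε
    rw [hG00, abs_le] at h
    rw [hG0, abs_le]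
    constructor <;> linarith [h.1, h.2, (hF01 n t).1]
  rcases le_or_gt 1 t with h1 | h1
  · have h := hn (m + 1) (by simp)
    have hG1 : G t = 1 := by simp [G, h1]
    have hG11 : G 1 = 1 := by simp [G]
    push_cast at h
    rw [div_self hm0.ne', hG11, abs_le] at h
    have h2 := hF n h1
    change |F n t - G t| ≤ ε
    rw [hG1, abs_le]
    constructor <;> linarith [h.1, h.2, (hF01 n t).2]
  · set k := ⌊t * (m + 1)⌋₊
    have hk1 : (k : ℝ) ≤ t * (m + 1) := Nat.floor_le (by positivity)
    have hk2 : t * (m + 1) < k + 1 := Nat.lt_floor_add_one _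
    have hkm : k < m + 1 := by
      have : (k : ℝ) < m + 1 := hk1.trans_lt (by nlinarith)
      exact_mod_cast this
    have hkm' : (k : ℝ) + 1 ≤ m + 1 := by exact_mod_cast hkm
    have hx := hn k (by simp; omega)
    have hy := hn (k + 1) (by simp; omega)
    push_cast at hy
    have hGx : G (k / (m + 1)) = k / (m + 1) := by
      have : (k : ℝ) / (m + 1) ≤ 1 := (div_le_one hm0).2 (by linarith)
      simp only [G]
      rw [min_eq_left this, max_eq_right (by positivity)]
    have hGy : G ((k + 1) / (m + 1)) = (k + 1) / (m + 1) := by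
      have : ((k : ℝ) + 1) / (m + 1) ≤ 1 := (div_le_one hm0).2 hkm'
      simp only [G]
      rw [min_eq_left this, max_eq_right (by positivity)]
    have := abs_sub_le_of_grid (hF n) hG (x := k / (m + 1)) (y := (k + 1) / (m + 1)) (t := t)
      ((div_le_iff₀ hm0).2 hk1) ((le_div_iff₀ hm0).2 hk2.le) hx hy (by
        rw [hGx, hGy, ← sub_div, add_sub_cancel_left]
        exact hm.le)
    linarith

/-- Absorbs the diagonal term n of the variance bound, since (ln n)^a = O(n). -/
theorem isBigO_natCast_sq_mul_log_rpow (a : ℝ) :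
    (fun n : ℕ => (n : ℝ)) =O[atTop] fun n : ℕ => (n : ℝ) ^ 2 * Real.log n ^ (-a) := by
  have h : (fun x : ℝ => Real.log x ^ a) =O[atTop] fun x : ℝ => x :=
    by simpa using (isLittleO_log_rpow_rpow_atTop a zero_lt_one).isBigO
  have h2 := (h.comp_tendsto tendsto_natCast_atTop_atTop).mul
    (isBigO_refl (fun n : ℕ => (n : ℝ) * Real.log n ^ (-a)) atTop)
  refine (h2.congr' ?_ ?_)
  · filter_upwards [eventually_gt_atTop 1] with n hn
    have : 0 < Real.log n := Real.log_pos (by exact_mod_cast hn)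
    simp only [Function.comp_apply]
    rw [mul_left_comm, ← Real.rpow_add this, add_neg_cancel, Real.rpow_zero, mul_one]
  · filter_upwards with n
    simp only [Function.comp_apply]
    ring

/-! ### The empirical distribution of the process -/

namespace IsStandardizedGaussianProcess

variable {Ω : Type*} [MeasurableSpace Ω] {P : Measure Ω} {X : ℕ → Ω → ℝ}

/-- The n diagonal covariances equal 1, and symmetry produces the factor 2 in Δ(n). -/
theorem sum_sum_abs_covariance_le [IsProbabilityMeasure P]
    (hX : IsStandardizedGaussianProcess X P) (n : ℕ) :
    ∑ i ∈ Finset.Icc 1 n, ∑ j ∈ Finset.Icc 1 n, |cov[X i, X j; P]| =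
      n + dependenceMeasure X P n := by
  induction n with
  | zero => simp [dependenceMeasure]
  | succ n ih =>
    have hdiag : cov[X (n + 1), X (n + 1); P] = 1 := by
      rw [covariance_self (hX.hasLaw _).aemeasurable, (hX.hasLaw _).variance_eq]
      simp
    have hsymm : ∑ i ∈ Finset.Icc 1 n, |cov[X (n + 1), X i; P]| =
        ∑ i ∈ Finset.Icc 1 n, |cov[X i, X (n + 1); P]| :=
      Finset.sum_congr rfl fun i _ => by rw [covariance_comm]
    simp only [Finset.sum_Icc_succ_top (Nat.le_add_left 1 n), Finset.sum_add_distrib, ih,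
      dependenceMeasure, hdiag, hsymm]
    have : Finset.Ico 1 (n + 1) = Finset.Icc 1 n := by ext; simp
    rw [this]
    push_cast
    rw [abs_one]
    ring

theorem variance_sum_indicator_le [IsProbabilityMeasure P]
    (hX : IsStandardizedGaussianProcess X P) (b : ℝ) (n : ℕ) :
    Var[fun ω => ∑ i ∈ Finset.Icc 1 n, (Set.Iic b).indicator (fun _ => (1 : ℝ)) (X i ω); P] ≤
      2 * (n + dependenceMeasure X P n) := by
  have hL (i : ℕ) : MemLp (fun ω => (Set.Iic b).indicator (fun _ => (1 : ℝ)) (X i ω)) 2 P := by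
    refine memLp_of_bounded (a := 0) (b := 1) (ae_of_all _ fun ω => ?_)
      ((measurable_const.indicator measurableSet_Iic).comp_aemeasurable
        (hX.hasLaw i).aemeasurable).aestronglyMeasurable 2
    by_cases h : X i ω ∈ Set.Iic b <;> simp [h]
  rw [variance_fun_sum' fun i _ => hL i, ← hX.sum_sum_abs_covariance_le, Finset.mul_sum]
  refine Finset.sum_le_sum fun i _ => ?_
  rw [Finset.mul_sum]
  exact Finset.sum_le_sum fun j _ => (le_abs_self _).trans
    (HasGaussianLaw.abs_covariance_indicator_le (hX.hasLaw i) (hX.hasLaw j)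
      hX.isGaussianProcess.hasGaussianLaw_prodMk b b)

theorem ae_tendsto_empiricalDist [IsProbabilityMeasure P]
    (hX : IsStandardizedGaussianProcess X P) {a : ℝ} (ha : 1 < a)
    (hΔ : (fun n : ℕ => dependenceMeasure X P n) =O[atTop]
      fun n : ℕ => (n : ℝ) ^ 2 * Real.log n ^ (-a)) (t : ℝ) :
    ∀ᵐ ω ∂P, Tendsto (fun n : ℕ => empiricalDist X n t ω) atTop (𝓝 (max 0 (min t 1))) := by
  rcases le_or_gt t 0 with h0 | h0
  · refine ae_of_all _ fun ω => ?_
    have (x : ℝ) : ¬ stdGaussianCDF x ≤ t := (h0.trans_lt (stdGaussianCDF_pos x)).not_ge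
    simp [empiricalDist, this, h0]
  rcases le_or_gt 1 t with h1 | h1
  · refine ae_of_all _ fun ω => ?_
    have (x : ℝ) : stdGaussianCDF x ≤ t := (stdGaussianCDF_lt_one x).le.trans h1
    refine tendsto_const_nhds.congr' ?_
    filter_upwards [eventually_gt_atTop 0] with n hn
    have : (n : ℝ) ≠ 0 := by exact_mod_cast hn.ne'
    simp_all [empiricalDist]
  · obtain ⟨b, rfl⟩ := exists_stdGaussianCDF_eq h0 h1
    have hm (i : ℕ) : AEMeasurable
        (fun ω => (Set.Iic b).indicator (fun _ => (1 : ℝ)) (X i ω)) P :=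
      (measurable_const.indicator measurableSet_Iic).comp_aemeasurable
        (hX.hasLaw i).aemeasurable
    have hmean (i : ℕ) : ∫ ω, (Set.Iic b).indicator (fun _ => (1 : ℝ)) (X i ω) ∂P =
        stdGaussianCDF b := by
      rw [← integral_map (hX.hasLaw i).aemeasurable
          (measurable_const.indicator measurableSet_Iic).aestronglyMeasurable,
        (hX.hasLaw i).map_eq, integral_indicator measurableSet_Iic, stdGaussianCDF, cdf_eq_real]
      simp
    have hvar : (fun n : ℕ => Var[fun ω => ∑ i ∈ Finset.Icc 1 n,
        (Set.Iic b).indicator (fun _ => (1 : ℝ)) (X i ω); P]) =O[atTop]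
        fun n : ℕ => (n : ℝ) ^ 2 * Real.log n ^ (-a) := by
      refine (IsBigO.of_bound 1 (Eventually.of_forall fun n => ?_)).trans
        (((isBigO_natCast_sq_mul_log_rpow a).add hΔ).const_mul_left 2)
      rw [Real.norm_of_nonneg (variance_nonneg _ _), one_mul]
      exact (hX.variance_sum_indicator_le b n).trans (le_abs_self _)
    filter_upwards [ae_tendsto_sum_div_of_isBigO_variance (fun i ω => by
      by_cases h : X i ω ∈ Set.Iic b <;> simp [h]) hm hmean ha hvar] with ω hω
    rw [min_eq_left h1.le, max_eq_right h0.le]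
    refine hω.congr fun n => ?_
    simp only [empiricalDist, strictMono_stdGaussianCDF.le_iff_le, Set.indicator_apply,
      Set.mem_Iic, Set.mem_ofPred_eq]
    ring

/-- Positivity of n matters: at n = 0 the factor 1 / n is 0 and the empirical function vanishes. -/
theorem integral_empiricalDist [IsProbabilityMeasure P]
    (hX : IsStandardizedGaussianProcess X P) {n : ℕ} (hn : 0 < n) (t : ℝ) :
    ∫ ω, empiricalDist X n t ω ∂P = max 0 (min t 1) := by
  have hs : MeasurableSet {x | stdGaussianCDF x ≤ t} :=
    measurableSet_le continuous_stdGaussianCDF.measurable measurable_const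
  have hnull (i : ℕ) : NullMeasurableSet {ω | stdGaussianCDF (X i ω) ≤ t} P :=
    (hX.hasLaw i).aemeasurable.nullMeasurable hs
  have hi (i : ℕ) : ∫ ω, Set.indicator {ω' : Ω | stdGaussianCDF (X i ω') ≤ t}
      (fun _ => (1 : ℝ)) ω ∂P = max 0 (min t 1) := by
    rw [integral_indicator₀ (hnull i), ← gaussianReal_real_stdGaussianCDF_le,
      ← (hX.hasLaw i).measureReal_eq hs]
    simp
  unfold empiricalDist
  rw [integral_const_mul, integral_finsetSum _ fun i _ =>
    (integrable_const (1 : ℝ)).indicator₀ (hnull i)]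
  have : (n : ℝ) ≠ 0 := by exact_mod_cast hn.ne'
  simp only [hi, Finset.sum_const, Nat.card_Icc, Nat.add_sub_cancel, nsmul_eq_mul]
  field_simp

end IsStandardizedGaussianProcess

theorem monotone_empiricalDist {Ω : Type*} (X : ℕ → Ω → ℝ) (n : ℕ) (ω : Ω) :
    Monotone fun t => empiricalDist X n t ω := fun _ _ hst =>
  mul_le_mul_of_nonneg_left (Finset.sum_le_sum fun _ _ =>
    Set.indicator_le_indicator_of_subset (fun _ h => le_trans h hst)
      (fun _ => zero_le_one) ω) (by positivity)

theorem mainTheorem4 {Ω : Type*} [MeasurableSpace Ω] (P : Measure Ω) [IsProbabilityMeasure P]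
    (X : ℕ → Ω → ℝ) (hX : IsStandardizedGaussianProcess X P)
    (δ : ℝ) (hδ : 0 < δ)
    (hΔ : (fun n : ℕ => dependenceMeasure X P n) =O[atTop]
      (fun n : ℕ => (n : ℝ) ^ 2 * (Real.log n) ^ (-3 - δ))) :
    ∀ᵐ ω ∂P, Tendsto (fun n : ℕ => uniformDeviation X P n ω) atTop (𝓝 0) := by
  have hΔ' : (fun n : ℕ => dependenceMeasure X P n) =O[atTop]
      fun n : ℕ => (n : ℝ) ^ 2 * Real.log n ^ (-(3 + δ)) := by
    simpa only [neg_add'] using hΔ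
  -- Countably many levels allow a single exceptional null set.
  filter_upwards [ae_all_iff.2 fun q : ℚ =>
    hX.ae_tendsto_empiricalDist (by linarith : 1 < 3 + δ) hΔ' q] with ω hω
  rw [Metric.tendsto_nhds]
  intro ε hε
  filter_upwards [eventually_forall_abs_sub_le_of_tendsto
    (fun n => monotone_empiricalDist X n ω) hω (fun n t => empiricalDist_mem_Icc X n t ω)
    (half_pos hε), eventually_gt_atTop 0] with n hn hn0
  have hle : uniformDeviation X P n ω ≤ ε / 2 :=
    ciSup_le fun t => by rw [hX.integral_empiricalDist hn0]; exact hn t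
  have hnonneg : 0 ≤ uniformDeviation X P n ω := Real.iSup_nonneg fun t => abs_nonneg _
  rw [Real.dist_eq, sub_zero, abs_of_nonneg hnonneg]
  linarith
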